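/- Consider $N$ independent two-state ($0$/$1$) Markov channels with common transition probabilities $p_{01},p_{11}\in[0,1]$ ($p_{jk}$ is the probability of moving from $j$ to $k$) and common reward $1$ for each sensed channel that is in state $1$. In every slot exactly $K$ channels are sensed, $1\le K<N$. Starting from a belief vector $\Omega(1)\in[0,1]^N$, the belief vector evolves by $\omega_i(t+1)=p_{11}$ if $i$ is sensed in slot $t$ and seen in state $1$, $\omega_i(t+1)=p_{01}$ if $i$ is sensed and seen in state $0$, and $\omega_i(t+1)=\mathcal T(\omega_i(t))$ if $i$ is not sensed, where $\mathcal T(\omega)=\omega p_{11}+(1-\omega)p_{01}$. Whittle's index. For a single channel with a subsidy $m\in\mathbb R$ for passivity, a passive slot pays $m$ and moves the belief $\omega$ to $\mathcal T(\omega)$; an active slot pays $\omega$ in expectation and moves the belief to $p_{11}$ with probability $\omega$ and to $p_{01}$ with probability $1-\omega$. Under the discounted criterion with factor $\beta\in[0,1)$ let $V_{\beta,m}(\omega)$ be the maximum expected total discounted reward from belief $\omega$, and call $\omega\in[0,1]$ passive under $m$ if $m+\beta V_{\beta,m}(\mathcal T(\omega))\ge \omega+\beta(\omega V_{\beta,m}(p_{11})+(1-\omega)V_{\beta,m}(p_{01}))$.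 Under the average reward criterion (where it is assumed that no state is absorbing: $p_{01}>0$, $p_{11}<1$) call $\omega\in[0,1]$ passive under $m$ if $m+h(\mathcal T(\omega))\ge\omega+\omega h(p_{11})+(1-\omega)h(p_{01})$ for some solution $(g,h)$, $g\in\mathbb R$ and $h$ continuous on $[0,1]$, of the average-reward optimality equation $g+h(x)=\max\{m+h(\mathcal T(x)),\,x+xh(p_{11})+(1-x)h(p_{01})\}$, $x\in[0,1]$. Whittle's index is $W(\omega)=\inf\{m:\omega\text{ is passive under }m\}$. A Whittle index policy senses in every slot $K$ channels whose current beliefs have the largest indices. The queue rule. Order the $N$ channels initially by non-increasing $\omega_i(1)$, and in each slot sense the $K$ channels at the head of the queue. At the end of the slot: (i) if $p_{11}\ge p_{01}$, the channels seen in state $1$ stay at the head, the channels seen in state $0$ go to the end, and the unobserved channels stay in between in their order; (ii) if $p_{11}<p_{01}$, the channels seen in state $0$ stay at the head, the channels seen in state $1$ go to the end, and the unobserved channels stay in between with their order reversed. The order inside the group of sensed channels seen in the same state is arbitrary. So, apart from the initial order and the observations, only the order of $p_{11}$ and $p_{01}$ enters the rule. Statement. Under both criteria the infimum defining $W(\omega)$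 is over a non-empty set bounded below, for every $\omega\in[0,1]$, and the queue rule is a Whittle index policy: for all state trajectories, in every slot the $K$ channels at the head of the queue have the largest Whittle indices. Under the discounted criterion, conversely, every Whittle index policy is the queue rule up to ties: along each of its runs there are orderings of the channels, the first by non-increasing initial belief, such that in every slot the sensed channels are the first $K$ of the current ordering, and the next ordering is obtained from the current one by the rule above up to exchanging channels that have equal beliefs. -/

import Mathlib

open Set

noncomputable section

namespace Whittle

/-! ### A single Gilbert-Elliot channel -/

/-- One-step belief update `𝒯(ω) = ω p₁₁ + (1 - ω) p₀₁` of an unobserved channel. -/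
def T (p01 p11 ω : ℝ) : ℝ := ω * p11 + (1 - ω) * p01

/-- Expected reward collected `t` slots from now in the single-armed bandit process with subsidy
`m`, from belief `ω`, under the (Markov, possibly time-dependent) policy `π`, where `π s ω` is the
action in slot `s` at belief `ω` (`true` = active, `false` = passive).  An active slot pays `ω` in
expectation and reveals the state, so that the next belief is `p11` with probability `ω` and `p01`
with probability `1 - ω`; a passive slot pays `m` and moves the belief to `𝒯(ω)`. -/
def slotReward (p01 p11 m : ℝ) : ℕ → (ℕ → ℝ → Bool) → ℝ → ℝ
  | 0, π, ω => if π 0 ω then ω else m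
  | t + 1, π, ω =>
      if π 0 ω then
        ω * slotReward p01 p11 m t (fun s => π (s + 1)) p11
          + (1 - ω) * slotReward p01 p11 m t (fun s => π (s + 1)) p01
      else slotReward p01 p11 m t (fun s => π (s + 1)) (T p01 p11 ω)

/-- Expected total discounted reward of the policy `π` from belief `ω`. -/
def policyValue (β p01 p11 m : ℝ) (π : ℕ → ℝ → Bool) (ω : ℝ) : ℝ :=
  ∑' t : ℕ, β ^ t * slotReward p01 p11 m t π ω

/-- The value function `V_{β,m}(ω)`: maximum expected total discounted reward. -/
def V (β p01 p11 m ω : ℝ) : ℝ := ⨆ π : ℕ → ℝ → Bool, policyValue β p01 p11 m π ω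

/-- `V_{β,m}(ω; u = 0)`: be passive in the first slot, then act optimally. -/
def Vpassive (β p01 p11 m ω : ℝ) : ℝ := m + β * V β p01 p11 m (T p01 p11 ω)

/-- `V_{β,m}(ω; u = 1)`: be active in the first slot, then act optimally. -/
def Vactive (β p01 p11 m ω : ℝ) : ℝ :=
  ω + β * (ω * V β p01 p11 m p11 + (1 - ω) * V β p01 p11 m p01)

/-- The passive set under subsidy `m`, discounted reward criterion. -/
def passiveSet (β p01 p11 m : ℝ) : Set ℝ :=
  {ω | ω ∈ Icc (0 : ℝ) 1 ∧ Vactive β p01 p11 m ω ≤ Vpassive β p01 p11 m ω}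

/-- `(g, h)` solves the average-reward optimality equation of the single-armed bandit process with
subsidy `m`: `g` is the optimal gain and `h` a continuous relative value function on the belief
space `[0, 1]`. -/
def IsAvgSolution (p01 p11 m g : ℝ) (h : ℝ → ℝ) : Prop :=
  ContinuousOn h (Icc (0 : ℝ) 1) ∧
    ∀ ω ∈ Icc (0 : ℝ) 1,
      g + h ω = max (m + h (T p01 p11 ω)) (ω + (ω * h p11 + (1 - ω) * h p01))

/-- The passive set under subsidy `m`, average reward criterion: the beliefs at which the passive
action attains the maximum in the average-reward optimality equation. -/
def avgPassiveSet (p01 p11 m : ℝ) : Set ℝ :=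
  {ω | ω ∈ Icc (0 : ℝ) 1 ∧ ∃ (g : ℝ) (h : ℝ → ℝ), IsAvgSolution p01 p11 m g h ∧
    ω + (ω * h p11 + (1 - ω) * h p01) ≤ m + h (T p01 p11 ω)}

/-- Whittle's index of the belief `ω` for a family `P` of passive sets: the infimum subsidy that
puts `ω` in the passive set. -/
def index (P : ℝ → Set ℝ) (ω : ℝ) : ℝ := sInf {m : ℝ | ω ∈ P m}

/-! ### `N` stochastically identical channels, `K` of which are sensed in each slot -/

variable {N : ℕ}

/-- The belief vector along a run.  Slots are numbered from `0`; `S t i` is the state of channel `i`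
in slot `t` (`true` = state `1`), `U t` the set of channels sensed in slot `t`, and `Ω₁` the initial
belief vector. -/
def belief (p01 p11 : ℝ) (Ω₁ : Fin N → ℝ) (S : ℕ → Fin N → Bool) (U : ℕ → Finset (Fin N)) :
    ℕ → Fin N → ℝ
  | 0 => Ω₁
  | t + 1 => fun i =>
      if i ∈ U t then (if S t i then p11 else p01)
      else T p01 p11 (belief p01 p11 Ω₁ S U t i)

/-- `U` consists of `K` channels whose current beliefs have the largest indices. -/
def IsIndexAction (W : ℝ → ℝ) (K : ℕ) (Ω : Fin N → ℝ) (U : Finset (Fin N)) : Prop :=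
  U.card = K ∧ ∀ i ∈ U, ∀ j ∉ U, W (Ω j) ≤ W (Ω i)

/-- The `K` channels at the head of the queue. -/
def head (K : ℕ) (q : List (Fin N)) : Finset (Fin N) := (q.take K).toFinset

/-- `q` lists every channel exactly once, in an order of non-increasing initial beliefs. -/
def IsInitialQueue (Ω₁ : Fin N → ℝ) (q : List (Fin N)) : Prop :=
  q.Perm (List.finRange N) ∧ q.Pairwise (fun i j => Ω₁ j ≤ Ω₁ i)

/-- The reordering rule at the end of a slot.  `ones` and `zeros` are the sensed channels seen in
state `1` and in state `0` (in any order within each group); `q.drop K` are the unobserved ones.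
Apart from the observations, the rule depends only on whether `positive` holds. -/
def QueueStep (positive : Prop) (K : ℕ) (s : Fin N → Bool) (q q' : List (Fin N)) : Prop :=
  ∃ ones zeros : List (Fin N),
    ones.Perm ((q.take K).filter fun i => s i) ∧
    zeros.Perm ((q.take K).filter fun i => !s i) ∧
    (positive → q' = ones ++ q.drop K ++ zeros) ∧
    (¬ positive → q' = zeros ++ (q.drop K).reverse ++ ones)

/-- A run of the queue rule along the states `S`. -/
def IsQueueRun (positive : Prop) (K : ℕ) (Ω₁ : Fin N → ℝ) (S : ℕ → Fin N → Bool)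
    (Q : ℕ → List (Fin N)) : Prop :=
  IsInitialQueue Ω₁ (Q 0) ∧ ∀ t, QueueStep positive K (S t) (Q t) (Q (t + 1))

end Whittle

end

open Set Filter Topology

namespace Whittle

/-! ### Belief updates and the advantage of being active -/

/-! Everything rests on the advantage `D` of acting over resting. The active value is affine in the
belief, and the passive one is a convex function composed with the affine map `T` as soon as the
continuation value is convex; so `D` is concave. At the two certain beliefs observing teaches
nothing, the continuations cancel, and `D 0 = -m`, `D 1 = 1 - m`. For `m < 1` a concave function
with `D 1 > 0` that is nonpositive at `x` is negative everywhere to the left of `x`; so the passive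
set is an initial segment of `[0, 1]`. For `m < 0` both endpoint values are positive and nothing is
passive; for `m ≥ 1` everything is. This alone makes the index monotone in the belief
(`IsThresholdFamily.monotoneOn`); monotonicity of the passive sets in `m` is never needed.

Convexity of the continuation value is proved differently for the two criteria. In the discounted
case `V` is a limit of convex value iterates (`convexOn_V`). In the average case a convexity defect
of a solution `h` would be carried along by `T` without shrinking, whereas continuity forces it to
vanish at the fixed point of `T` (`IsAvgSolution.convexOn`). In the discounted case continuity of
`V` in `m` also makes the index strictly monotone.

The queue rule keeps the channels sorted by belief (`IsInitialQueue.step`), so a monotone index is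
largest at the head. Conversely, a strictly monotone index selects largest beliefs, hence the head
of some sorted queue, and two sorted queues differ only by ties. -/

lemma T_mem {p01 p11 ω : ℝ} (h0 : p01 ∈ Icc (0 : ℝ) 1) (h1 : p11 ∈ Icc (0 : ℝ) 1)
    (hω : ω ∈ Icc (0 : ℝ) 1) : T p01 p11 ω ∈ Icc (0 : ℝ) 1 :=
  convex_Icc (0 : ℝ) 1 h1 h0 hω.1 (sub_nonneg.2 hω.2) (by ring)

lemma T_combo {p01 p11 x y a b : ℝ} (hab : a + b = 1) :
    T p01 p11 (a * x + b * y) = a * T p01 p11 x + b * T p01 p11 y := by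
  obtain rfl : b = 1 - a := by linarith
  unfold T; ring

/-- Value of the active action minus that of the passive one, for the continuation value `f`. -/
def advantage (β p01 p11 m : ℝ) (f : ℝ → ℝ) (ω : ℝ) : ℝ :=
  ω + β * (ω * f p11 + (1 - ω) * f p01) - (m + β * f (T p01 p11 ω))

lemma advantage_zero (β p01 p11 m : ℝ) (f : ℝ → ℝ) : advantage β p01 p11 m f 0 = -m := by
  simp [advantage, T]

lemma advantage_one (β p01 p11 m : ℝ) (f : ℝ → ℝ) : advantage β p01 p11 m f 1 = 1 - m := by
  simp [advantage, T]

lemma concaveOn_advantage {β p01 p11 : ℝ} (m : ℝ) {f : ℝ → ℝ} (hβ : 0 ≤ β)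
    (h0 : p01 ∈ Icc (0 : ℝ) 1) (h1 : p11 ∈ Icc (0 : ℝ) 1) (hf : ConvexOn ℝ (Icc 0 1) f) :
    ConcaveOn ℝ (Icc 0 1) (advantage β p01 p11 m f) := by
  refine ⟨convex_Icc 0 1, fun x hx y hy a b ha hb hab => ?_⟩
  have h := mul_le_mul_of_nonneg_left (hf.2 (T_mem h0 h1 hx) (T_mem h0 h1 hy) ha hb hab) hβ
  simp only [smul_eq_mul] at h ⊢
  unfold advantage
  rw [T_combo hab]
  obtain rfl : b = 1 - a := by linarith
  linarith

/-- The point `x` is a convex combination of `y` and `1` with positive weight on `1`; if `D y` were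
nonnegative, concavity and `D 1 > 0` would make `D x` positive. -/
lemma neg_of_concaveOn {D : ℝ → ℝ} (hD : ConcaveOn ℝ (Icc 0 1) D) (h1 : 0 < D 1) {x y : ℝ}
    (hy : y ∈ Icc (0 : ℝ) 1) (hx : x ∈ Icc (0 : ℝ) 1) (hyx : y < x) (hDx : D x ≤ 0) :
    D y < 0 := by
  by_contra! hDy
  have hy1 : 0 < 1 - y := by linarith [hx.2]
  have ha : 0 ≤ (1 - x) / (1 - y) := div_nonneg (sub_nonneg.2 hx.2) hy1.le
  have hb : 0 < (x - y) / (1 - y) := div_pos (sub_pos.2 hyx) hy1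
  have h := hD.2 hy (right_mem_Icc.2 zero_le_one) ha hb.le (by field_simp; ring)
  have hc : ((1 - x) / (1 - y)) • y + ((x - y) / (1 - y)) • (1 : ℝ) = x := by
    simp only [smul_eq_mul]; field_simp; ring
  rw [hc] at h
  simp only [smul_eq_mul] at h
  linarith [mul_nonneg ha hDy, mul_pos hb h1]

/-! ### Families of passive sets and their index -/

/-- The properties of a family of passive sets that make the index monotone. -/
structure IsThresholdFamily (P : ℝ → Set ℝ) : Prop where
  eq_empty : ∀ m < 0, P m = ∅
  eq_Icc : ∀ m, 1 ≤ m → P m = Icc 0 1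
  lower : ∀ m, ∀ x ∈ P m, ∀ y ∈ Icc (0 : ℝ) 1, y ≤ x → y ∈ P m

lemma IsThresholdFamily.isGLB {P : ℝ → Set ℝ} (hP : IsThresholdFamily P) {ω : ℝ}
    (hω : ω ∈ Icc (0 : ℝ) 1) : IsGLB {m : ℝ | ω ∈ P m} (index P ω) := by
  refine isGLB_csInf ⟨1, ?_⟩ ⟨0, fun m hm => ?_⟩
  · simpa [hP.eq_Icc 1 le_rfl] using hω
  · by_contra! h
    simp [hP.eq_empty m h] at hm

/-- Each subsidy that makes `x` passive also makes every smaller belief passive, so the infimum for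
the smaller belief is over a larger set. -/
lemma IsThresholdFamily.monotoneOn {P : ℝ → Set ℝ} (hP : IsThresholdFamily P) :
    MonotoneOn (index P) (Icc 0 1) := fun y hy x hx hyx =>
  (hP.isGLB hx).2 fun m hm => (hP.isGLB hy).1 (hP.lower m x hm y hy hyx)

/-! ### The discounted value function -/

section Discounted

variable {β p01 p11 m : ℝ}

/-! ### Bounds and one-step recursion for policy values -/

lemma abs_combo_le {x y ω C : ℝ} (hω : ω ∈ Icc (0 : ℝ) 1) (hx : |x| ≤ C) (hy : |y| ≤ C) :
    |ω * x + (1 - ω) * y| ≤ C := by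
  rw [abs_le] at *
  exact convex_Icc (-C) C hx hy hω.1 (sub_nonneg.2 hω.2) (by ring)

lemma abs_slotReward_le (h0 : p01 ∈ Icc (0 : ℝ) 1) (h1 : p11 ∈ Icc (0 : ℝ) 1) (m : ℝ) (t : ℕ) :
    ∀ (π : ℕ → ℝ → Bool) (ω : ℝ), ω ∈ Icc (0 : ℝ) 1 →
      |slotReward p01 p11 m t π ω| ≤ max 1 |m| := by
  induction t with
  | zero =>
    intro π ω hω
    unfold slotReward
    split_ifs
    · rw [abs_of_nonneg hω.1]; exact hω.2.trans (le_max_left _ _)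
    · exact le_max_right _ _
  | succ t ih =>
    intro π ω hω
    unfold slotReward
    split_ifs
    · exact abs_combo_le hω (ih _ _ h1) (ih _ _ h0)
    · exact ih _ _ (T_mem h0 h1 hω)

lemma abs_discounted_slotReward_le (hβ : 0 ≤ β) (h0 : p01 ∈ Icc (0 : ℝ) 1)
    (h1 : p11 ∈ Icc (0 : ℝ) 1) (m : ℝ) (π : ℕ → ℝ → Bool) {ω : ℝ} (hω : ω ∈ Icc (0 : ℝ) 1) (t : ℕ) :
    ‖β ^ t * slotReward p01 p11 m t π ω‖ ≤ β ^ t * max 1 |m| := by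
  rw [norm_mul, Real.norm_eq_abs, Real.norm_eq_abs, abs_of_nonneg (pow_nonneg hβ t)]
  exact mul_le_mul_of_nonneg_left (abs_slotReward_le h0 h1 m t π ω hω) (pow_nonneg hβ t)

lemma summable_slotReward (hβ : β ∈ Ico (0 : ℝ) 1) (h0 : p01 ∈ Icc (0 : ℝ) 1)
    (h1 : p11 ∈ Icc (0 : ℝ) 1) (m : ℝ) (π : ℕ → ℝ → Bool) {ω : ℝ} (hω : ω ∈ Icc (0 : ℝ) 1) :
    Summable fun t => β ^ t * slotReward p01 p11 m t π ω :=
  .of_norm_bounded ((summable_geometric_of_lt_one hβ.1 hβ.2).mul_right _)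
    (abs_discounted_slotReward_le hβ.1 h0 h1 m π hω)

lemma abs_policyValue_le (hβ : β ∈ Ico (0 : ℝ) 1) (h0 : p01 ∈ Icc (0 : ℝ) 1)
    (h1 : p11 ∈ Icc (0 : ℝ) 1) (m : ℝ) (π : ℕ → ℝ → Bool) {ω : ℝ} (hω : ω ∈ Icc (0 : ℝ) 1) :
    |policyValue β p01 p11 m π ω| ≤ (1 - β)⁻¹ * max 1 |m| :=
  tsum_of_norm_bounded ((hasSum_geometric_of_lt_one hβ.1 hβ.2).mul_right _)
    (abs_discounted_slotReward_le hβ.1 h0 h1 m π hω)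

lemma policyValue_eq (hβ : β ∈ Ico (0 : ℝ) 1) (h0 : p01 ∈ Icc (0 : ℝ) 1)
    (h1 : p11 ∈ Icc (0 : ℝ) 1) (m : ℝ) (π : ℕ → ℝ → Bool) {ω : ℝ} (hω : ω ∈ Icc (0 : ℝ) 1) :
    policyValue β p01 p11 m π ω =
      if π 0 ω then
        ω + β * (ω * policyValue β p01 p11 m (fun s => π (s + 1)) p11
          + (1 - ω) * policyValue β p01 p11 m (fun s => π (s + 1)) p01)
      else m + β * policyValue β p01 p11 m (fun s => π (s + 1)) (T p01 p11 ω) := by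
  rw [policyValue, (summable_slotReward hβ h0 h1 m π hω).tsum_eq_zero_add]
  split_ifs with h
  · simp only [slotReward, h, if_true, pow_zero, one_mul, policyValue]
    rw [← tsum_mul_left, ← tsum_mul_left, ← Summable.tsum_add, ← tsum_mul_left]
    · congr 2; ext t; ring
    · exact (summable_slotReward hβ h0 h1 m _ h1).mul_left _
    · exact (summable_slotReward hβ h0 h1 m _ h0).mul_left _
  · simp only [slotReward, h, if_false, pow_zero, one_mul, policyValue, Bool.false_eq_true]
    rw [← tsum_mul_left]
    congr 2; ext t; ring

/-- The dynamic programming operator of the discounted single-armed bandit. -/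
def bellman (β p01 p11 m : ℝ) (f : ℝ → ℝ) (ω : ℝ) : ℝ :=
  max (m + β * f (T p01 p11 ω)) (ω + β * (ω * f p11 + (1 - ω) * f p01))

/-- Value iteration from `0`. -/
def valueIter (β p01 p11 m : ℝ) : ℕ → ℝ → ℝ
  | 0 => 0
  | n + 1 => bellman β p01 p11 m (valueIter β p01 p11 m n)

/-! ### Value iteration approximates the value function -/

lemma combo_le_combo {x y x' y' ω c : ℝ} (hω : ω ∈ Icc (0 : ℝ) 1) (hx : x ≤ x' + c)
    (hy : y ≤ y' + c) : ω * x + (1 - ω) * y ≤ ω * x' + (1 - ω) * y' + c := by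
  linarith [mul_le_mul_of_nonneg_left hx hω.1,
    mul_le_mul_of_nonneg_left hy (sub_nonneg.2 hω.2)]

/-- With the next lemma this encloses the supremum `V` between value iterates up to a geometric
error, so that no Bellman equation for `V` itself is required. The error for `n = 0` is the uniform
bound on policy values, and each step multiplies it by `β`. -/
lemma policyValue_le_valueIter (hβ : β ∈ Ico (0 : ℝ) 1) (h0 : p01 ∈ Icc (0 : ℝ) 1)
    (h1 : p11 ∈ Icc (0 : ℝ) 1) (m : ℝ) (n : ℕ) :
    ∀ (π : ℕ → ℝ → Bool) (ω : ℝ), ω ∈ Icc (0 : ℝ) 1 →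
      policyValue β p01 p11 m π ω ≤
        valueIter β p01 p11 m n ω + β ^ n * ((1 - β)⁻¹ * max 1 |m|) := by
  induction n with
  | zero =>
    intro π ω hω
    simpa [valueIter] using (abs_le.1 (abs_policyValue_le hβ h0 h1 m π hω)).2
  | succ n ih =>
    intro π ω hω
    rw [policyValue_eq hβ h0 h1 m π hω, valueIter, bellman, pow_succ]
    split_ifs
    · refine le_trans ?_ (add_le_add_left (le_max_right _ _) _)
      have := mul_le_mul_of_nonneg_left (combo_le_combo hω (ih (fun s => π (s + 1)) _ h1)
        (ih (fun s => π (s + 1)) _ h0)) hβ.1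
      linarith
    · refine le_trans ?_ (add_le_add_left (le_max_left _ _) _)
      have := mul_le_mul_of_nonneg_left (ih (fun s => π (s + 1)) _ (T_mem h0 h1 hω)) hβ.1
      linarith

lemma exists_policy_valueIter_le (hβ : β ∈ Ico (0 : ℝ) 1) (h0 : p01 ∈ Icc (0 : ℝ) 1)
    (h1 : p11 ∈ Icc (0 : ℝ) 1) (m : ℝ) (n : ℕ) :
    ∃ π : ℕ → ℝ → Bool, ∀ ω ∈ Icc (0 : ℝ) 1,
      valueIter β p01 p11 m n ω ≤
        policyValue β p01 p11 m π ω + β ^ n * ((1 - β)⁻¹ * max 1 |m|) := by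
  classical
  induction n with
  | zero =>
    refine ⟨fun _ _ => true, fun ω hω => ?_⟩
    have := (abs_le.1 (abs_policyValue_le hβ h0 h1 m (fun _ _ => true) hω)).1
    simp only [valueIter, Pi.zero_apply, pow_zero, one_mul]
    linarith
  | succ n ih =>
    obtain ⟨π, hπ⟩ := ih
    set f := valueIter β p01 p11 m n
    -- Act greedily with respect to the current iterate in slot `0`, then follow the policy obtained
    -- for one step less; this is why policies may depend on time.
    let π' : ℕ → ℝ → Bool := fun s => Nat.casesOn s
      (fun ω => decide (m + β * f (T p01 p11 ω) ≤ ω + β * (ω * f p11 + (1 - ω) * f p01))) π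
    refine ⟨π', fun ω hω => ?_⟩
    rw [policyValue_eq hβ h0 h1 m π' hω, valueIter, bellman, pow_succ]
    change max (m + β * f (T p01 p11 ω)) (ω + β * (ω * f p11 + (1 - ω) * f p01)) ≤
      (if decide (m + β * f (T p01 p11 ω) ≤ ω + β * (ω * f p11 + (1 - ω) * f p01)) = true then
        ω + β * (ω * policyValue β p01 p11 m π p11 + (1 - ω) * policyValue β p01 p11 m π p01)
      else m + β * policyValue β p01 p11 m π (T p01 p11 ω)) + _
    by_cases h : m + β * f (T p01 p11 ω) ≤ ω + β * (ω * f p11 + (1 - ω) * f p01)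
    · rw [if_pos (by simpa using h), max_eq_right h]
      have := mul_le_mul_of_nonneg_left (combo_le_combo hω (hπ _ h1) (hπ _ h0)) hβ.1
      linarith
    · rw [if_neg (by simpa using h), max_eq_left (le_of_not_ge h)]
      have := mul_le_mul_of_nonneg_left (hπ _ (T_mem h0 h1 hω)) hβ.1
      linarith

lemma abs_V_sub_valueIter_le (hβ : β ∈ Ico (0 : ℝ) 1) (h0 : p01 ∈ Icc (0 : ℝ) 1)
    (h1 : p11 ∈ Icc (0 : ℝ) 1) (m : ℝ) (n : ℕ) {ω : ℝ} (hω : ω ∈ Icc (0 : ℝ) 1) :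
    |V β p01 p11 m ω - valueIter β p01 p11 m n ω| ≤ β ^ n * ((1 - β)⁻¹ * max 1 |m|) := by
  have hle := fun π => policyValue_le_valueIter hβ h0 h1 m n π ω hω
  obtain ⟨π, hπ⟩ := exists_policy_valueIter_le hβ h0 h1 m n
  have hup : V β p01 p11 m ω ≤ _ := ciSup_le hle
  have hlo : policyValue β p01 p11 m π ω ≤ V β p01 p11 m ω :=
    le_ciSup (f := fun π => policyValue β p01 p11 m π ω)
      ⟨_, by rintro _ ⟨π, rfl⟩; exact hle π⟩ π
  have := hπ ω hω
  rw [abs_le]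
  constructor <;> linarith

lemma tendsto_valueIter (hβ : β ∈ Ico (0 : ℝ) 1) (h0 : p01 ∈ Icc (0 : ℝ) 1)
    (h1 : p11 ∈ Icc (0 : ℝ) 1) (m : ℝ) {ω : ℝ} (hω : ω ∈ Icc (0 : ℝ) 1) :
    Tendsto (fun n => valueIter β p01 p11 m n ω) atTop (𝓝 (V β p01 p11 m ω)) := by
  rw [tendsto_iff_dist_tendsto_zero]
  refine squeeze_zero (fun _ => dist_nonneg) (fun n => ?_)
    (zero_mul ((1 - β)⁻¹ * max 1 |m|) ▸
      (tendsto_pow_atTop_nhds_zero_of_lt_one hβ.1 hβ.2).mul_const _)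
  rw [dist_comm, Real.dist_eq]
  exact abs_V_sub_valueIter_le hβ h0 h1 m n hω

/-- The Bellman operator takes the maximum of a convex function composed with the affine map `T` and
a function affine in the belief, so it preserves convexity. -/
lemma convexOn_valueIter (hβ : 0 ≤ β) (h0 : p01 ∈ Icc (0 : ℝ) 1)
    (h1 : p11 ∈ Icc (0 : ℝ) 1) (m : ℝ) (n : ℕ) :
    ConvexOn ℝ (Icc 0 1) (valueIter β p01 p11 m n) := by
  induction n with
  | zero => exact convexOn_const 0 (convex_Icc 0 1)
  | succ n ih =>
    refine ConvexOn.sup (f := fun ω => m + β * valueIter β p01 p11 m n (T p01 p11 ω))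
      (g := fun ω => ω + β * (ω * valueIter β p01 p11 m n p11
        + (1 - ω) * valueIter β p01 p11 m n p01)) ⟨convex_Icc 0 1, ?_⟩ ⟨convex_Icc 0 1, ?_⟩
    · intro x hx y hy a b ha hb hab
      have h := mul_le_mul_of_nonneg_left
        (ih.2 (T_mem h0 h1 hx) (T_mem h0 h1 hy) ha hb hab) hβ
      simp only [smul_eq_mul] at h ⊢
      rw [T_combo hab]
      obtain rfl : b = 1 - a := by linarith
      linarith
    · intro x hx y hy a b ha hb hab
      simp only [smul_eq_mul]
      obtain rfl : b = 1 - a := by linarith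
      exact le_of_eq (by ring)

lemma convexOn_V (hβ : β ∈ Ico (0 : ℝ) 1) (h0 : p01 ∈ Icc (0 : ℝ) 1)
    (h1 : p11 ∈ Icc (0 : ℝ) 1) (m : ℝ) : ConvexOn ℝ (Icc 0 1) (V β p01 p11 m) :=
  ⟨convex_Icc 0 1, fun _ hx _ hy a b ha hb hab =>
    le_of_tendsto_of_tendsto'
      (tendsto_valueIter hβ h0 h1 m (convex_Icc (0 : ℝ) 1 hx hy ha hb hab))
      (((tendsto_valueIter hβ h0 h1 m hx).const_smul a).add
        ((tendsto_valueIter hβ h0 h1 m hy).const_smul b))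
      fun n => (convexOn_valueIter hβ.1 h0 h1 m n).2 hx hy ha hb hab⟩

/-! ### Dependence of the value function on the subsidy -/

lemma abs_valueIter_sub_le (hβ : β ∈ Ico (0 : ℝ) 1) (h0 : p01 ∈ Icc (0 : ℝ) 1)
    (h1 : p11 ∈ Icc (0 : ℝ) 1) (m m' : ℝ) (n : ℕ) :
    ∀ ω ∈ Icc (0 : ℝ) 1, |valueIter β p01 p11 m n ω - valueIter β p01 p11 m' n ω| ≤
      (1 - β)⁻¹ * |m - m'| := by
  have hpos : 0 < 1 - β := sub_pos.2 hβ.2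
  induction n with
  | zero => intro ω _; simp only [valueIter, sub_self, abs_zero]; positivity
  | succ n ih =>
    intro ω hω
    -- The Lipschitz constant comes from the fixed point of `c ↦ |m - m'| + β * c`, so the same
    -- bound reproduces itself at every iteration.
    have hfix : |m - m'| + β * ((1 - β)⁻¹ * |m - m'|) = (1 - β)⁻¹ * |m - m'| := by
      field_simp; ring
    refine (abs_max_sub_max_le_max _ _ _ _).trans (max_le ?_ ?_)
    · have h := mul_le_mul_of_nonneg_left (ih _ (T_mem h0 h1 hω)) hβ.1
      rw [← hfix]
      refine le_trans (le_of_eq ?_) ((abs_add_le (m - m') (β * (valueIter β p01 p11 m n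
        (T p01 p11 ω) - valueIter β p01 p11 m' n (T p01 p11 ω)))).trans ?_)
      · congr 1; ring
      · rw [abs_mul, abs_of_nonneg hβ.1]; linarith
    · have h := mul_le_mul_of_nonneg_left (abs_combo_le hω (ih _ h1) (ih _ h0)) hβ.1
      rw [← hfix]
      refine le_trans (le_of_eq ?_) (h.trans (le_add_of_nonneg_left (abs_nonneg _)))
      rw [← abs_of_nonneg hβ.1, ← abs_mul, abs_of_nonneg hβ.1]
      congr 1; ring

lemma continuous_V_subsidy (hβ : β ∈ Ico (0 : ℝ) 1) (h0 : p01 ∈ Icc (0 : ℝ) 1)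
    (h1 : p11 ∈ Icc (0 : ℝ) 1) {ω : ℝ} (hω : ω ∈ Icc (0 : ℝ) 1) :
    Continuous fun m => V β p01 p11 m ω := by
  have hpos : 0 ≤ (1 - β)⁻¹ := inv_nonneg.2 (sub_nonneg.2 hβ.2.le)
  refine (LipschitzWith.of_dist_le_mul (K := ⟨(1 - β)⁻¹, hpos⟩) fun m m' => ?_).continuous
  exact le_of_tendsto' ((tendsto_valueIter hβ h0 h1 m hω).sub
    (tendsto_valueIter hβ h0 h1 m' hω)).abs fun n => abs_valueIter_sub_le hβ h0 h1 m m' n ω hω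

/-- A subsidy of at least `1` dominates any immediate reward; once an iterate is constant in the
belief, resting is optimal everywhere and the next iterate is constant too. -/
lemma valueIter_eq_of_one_le (h0 : p01 ∈ Icc (0 : ℝ) 1)
    (h1 : p11 ∈ Icc (0 : ℝ) 1) (hm : 1 ≤ m) (n : ℕ) :
    ∀ ω ∈ Icc (0 : ℝ) 1, valueIter β p01 p11 m n ω = valueIter β p01 p11 m n 0 := by
  induction n with
  | zero => intro ω _; rfl
  | succ n ih =>
    have key : ∀ ω ∈ Icc (0 : ℝ) 1, valueIter β p01 p11 m (n + 1) ω =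
        m + β * valueIter β p01 p11 m n 0 := fun ω hω => by
      rw [valueIter, bellman, ih _ (T_mem h0 h1 hω), ih _ h1, ih _ h0]
      exact max_eq_left (by linarith [hω.2])
    intro ω hω
    rw [key ω hω, key 0 (left_mem_Icc.2 zero_le_one)]

lemma V_eq_of_one_le (hβ : β ∈ Ico (0 : ℝ) 1) (h0 : p01 ∈ Icc (0 : ℝ) 1)
    (h1 : p11 ∈ Icc (0 : ℝ) 1) (hm : 1 ≤ m) {ω : ℝ} (hω : ω ∈ Icc (0 : ℝ) 1) :
    V β p01 p11 m ω = V β p01 p11 m 0 := by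
  refine tendsto_nhds_unique (tendsto_valueIter hβ h0 h1 m hω) ?_
  simp only [valueIter_eq_of_one_le h0 h1 hm _ ω hω]
  exact tendsto_valueIter hβ h0 h1 m (left_mem_Icc.2 zero_le_one)

lemma advantage_V_of_one_le (hβ : β ∈ Ico (0 : ℝ) 1) (h0 : p01 ∈ Icc (0 : ℝ) 1)
    (h1 : p11 ∈ Icc (0 : ℝ) 1) (hm : 1 ≤ m) {ω : ℝ} (hω : ω ∈ Icc (0 : ℝ) 1) :
    advantage β p01 p11 m (V β p01 p11 m) ω = ω - m := by
  rw [advantage, V_eq_of_one_le hβ h0 h1 hm (T_mem h0 h1 hω), V_eq_of_one_le hβ h0 h1 hm h1,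
    V_eq_of_one_le hβ h0 h1 hm h0]
  ring

/-! ### Discounted passive sets are initial segments -/

lemma mem_passiveSet_iff {ω : ℝ} : ω ∈ passiveSet β p01 p11 m ↔
    ω ∈ Icc (0 : ℝ) 1 ∧ advantage β p01 p11 m (V β p01 p11 m) ω ≤ 0 := by
  rw [passiveSet, mem_ofPred_eq, Vactive, Vpassive, advantage, sub_nonpos]

lemma advantage_neg_of_lt (hβ : β ∈ Ico (0 : ℝ) 1) (h0 : p01 ∈ Icc (0 : ℝ) 1)
    (h1 : p11 ∈ Icc (0 : ℝ) 1) {x y : ℝ} (hx : x ∈ passiveSet β p01 p11 m)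
    (hy : y ∈ Icc (0 : ℝ) 1) (hyx : y < x) : advantage β p01 p11 m (V β p01 p11 m) y < 0 := by
  obtain ⟨hxI, hx⟩ := mem_passiveSet_iff.1 hx
  -- For `m ≥ 1` the endpoint value `1 - m` is not positive, so the concavity argument is
  -- unavailable; there the advantage is explicitly `y - m`, negative since `y < x ≤ 1 ≤ m`.
  rcases le_or_gt 1 m with hm | hm
  · rw [advantage_V_of_one_le hβ h0 h1 hm hy]
    linarith [hxI.2]
  · exact neg_of_concaveOn (concaveOn_advantage m hβ.1 h0 h1 (convexOn_V hβ h0 h1 m))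
      (by rw [advantage_one]; linarith) hy hxI hyx hx

/-- A concave function on `[0, 1]` is at least the smaller of its endpoint values, here `-m` and `1
- m`. -/
lemma pos_of_concaveOn_advantage {f : ℝ → ℝ} (hm : m < 0)
    (hD : ConcaveOn ℝ (Icc 0 1) (advantage β p01 p11 m f)) {ω : ℝ} (hω : ω ∈ Icc (0 : ℝ) 1) :
    0 < advantage β p01 p11 m f ω := by
  have h := hD.min_le_of_mem_Icc (left_mem_Icc.2 zero_le_one) (right_mem_Icc.2 zero_le_one) hω
  rw [advantage_zero, advantage_one] at h
  exact lt_of_lt_of_le (lt_min (by linarith) (by linarith)) h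

lemma isThresholdFamily_passiveSet (hβ : β ∈ Ico (0 : ℝ) 1) (h0 : p01 ∈ Icc (0 : ℝ) 1)
    (h1 : p11 ∈ Icc (0 : ℝ) 1) : IsThresholdFamily (passiveSet β p01 p11) where
  eq_empty m hm := by
    refine eq_empty_of_forall_notMem fun ω h => ?_
    rw [mem_passiveSet_iff] at h
    exact h.2.not_gt (pos_of_concaveOn_advantage hm
      (concaveOn_advantage m hβ.1 h0 h1 (convexOn_V hβ h0 h1 m)) h.1)
  eq_Icc m hm := Subset.antisymm (fun _ h => h.1) fun ω hω => by
    rw [mem_passiveSet_iff, advantage_V_of_one_le hβ h0 h1 hm hω]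
    exact ⟨hω, by linarith [hω.2]⟩
  lower m x hx y hy hyx := by
    rcases hyx.eq_or_lt with rfl | hlt
    · exact hx
    · exact mem_passiveSet_iff.2 ⟨hy, (advantage_neg_of_lt hβ h0 h1 hx hy hlt).le⟩

lemma continuous_advantage_V (hβ : β ∈ Ico (0 : ℝ) 1) (h0 : p01 ∈ Icc (0 : ℝ) 1)
    (h1 : p11 ∈ Icc (0 : ℝ) 1) {ω : ℝ} (hω : ω ∈ Icc (0 : ℝ) 1) :
    Continuous fun m => advantage β p01 p11 m (V β p01 p11 m) ω := by
  have := continuous_V_subsidy hβ h0 h1 h0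
  have := continuous_V_subsidy hβ h0 h1 h1
  have := continuous_V_subsidy hβ h0 h1 (T_mem h0 h1 hω)
  unfold advantage
  fun_prop

/-- Continuity in the subsidy shows that the infimum for `x` is attained. At that subsidy a belief
`y < x` has strictly negative advantage, and still does at a slightly smaller subsidy, which
therefore bounds the index of `y`. -/
lemma strictMonoOn_index_passiveSet (hβ : β ∈ Ico (0 : ℝ) 1) (h0 : p01 ∈ Icc (0 : ℝ) 1)
    (h1 : p11 ∈ Icc (0 : ℝ) 1) : StrictMonoOn (index (passiveSet β p01 p11)) (Icc 0 1) := by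
  intro y hy x hx hyx
  have hP := isThresholdFamily_passiveSet hβ h0 h1
  have hclosed : IsClosed {m : ℝ | x ∈ passiveSet β p01 p11 m} := by
    simp only [mem_passiveSet_iff, hx, true_and]
    exact isClosed_le (continuous_advantage_V hβ h0 h1 hx) continuous_const
  have hmem : x ∈ passiveSet β p01 p11 (index (passiveSet β p01 p11) x) :=
    (hP.isGLB hx).mem_of_isClosed ⟨1, by simpa [hP.eq_Icc 1 le_rfl] using hx⟩ hclosed
  have hneg := advantage_neg_of_lt hβ h0 h1 hmem hy hyx
  have hev := (continuous_advantage_V hβ h0 h1 hy).continuousAt.eventually (gt_mem_nhds hneg)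
  obtain ⟨m, hm, hlt⟩ := hev.exists_lt
  exact ((hP.isGLB hy).1 (mem_passiveSet_iff.2 ⟨hy, hlt.le⟩)).trans_lt hm

end Discounted

/-! ### The average-reward optimality equation -/

section Average

variable {p01 p11 m g : ℝ} {h : ℝ → ℝ}

lemma iterate_T_mem (h0 : p01 ∈ Icc (0 : ℝ) 1) (h1 : p11 ∈ Icc (0 : ℝ) 1) {x : ℝ}
    (hx : x ∈ Icc (0 : ℝ) 1) (n : ℕ) : (T p01 p11)^[n] x ∈ Icc (0 : ℝ) 1 := by
  induction n with
  | zero => exact hx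
  | succ n ih => rw [Function.iterate_succ_apply']; exact T_mem h0 h1 ih

lemma tendsto_iterate_T (hlt : |p11 - p01| < 1) (x : ℝ) :
    Tendsto (fun n => (T p01 p11)^[n] x) atTop (𝓝 (p01 / (1 - (p11 - p01)))) := by
  have hne : 1 - (p11 - p01) ≠ 0 := by linarith [(abs_lt.1 hlt).2]
  set c := p01 / (1 - (p11 - p01)) with hc
  have hfix : p01 = c * (1 - (p11 - p01)) := by rw [hc]; field_simp
  -- `c` is the fixed point of `T`, and `T` contracts towards it with ratio `p11 - p01`.
  have hform : ∀ n, (T p01 p11)^[n] x = c + (p11 - p01) ^ n * (x - c) := by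
    intro n
    induction n with
    | zero => simp
    | succ n ih =>
      rw [Function.iterate_succ_apply', ih, pow_succ, T]
      linear_combination hfix
  simp only [hform]
  simpa using ((tendsto_pow_atTop_nhds_zero_of_abs_lt_one hlt).mul_const (x - c)).const_add c

/-- A violation of convexity can only come from a passive belief, and it is then passed on to the
updated beliefs. -/
lemma IsAvgSolution.convexity_defect (hs : IsAvgSolution p01 p11 m g h)
    {x y a b : ℝ} (hx : x ∈ Icc (0 : ℝ) 1) (hy : y ∈ Icc (0 : ℝ) 1)
    (ha : 0 ≤ a) (hb : 0 ≤ b) (hab : a + b = 1)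
    (hE : 0 < h (a * x + b * y) - (a * h x + b * h y)) :
    g + h (a * x + b * y) = m + h (T p01 p11 (a * x + b * y)) ∧
    h (a * x + b * y) - (a * h x + b * h y) ≤
      h (a * T p01 p11 x + b * T p01 p11 y) - (a * h (T p01 p11 x) + b * h (T p01 p11 y)) := by
  have hz : a * x + b * y ∈ Icc (0 : ℝ) 1 := convex_Icc (0 : ℝ) 1 hx hy ha hb hab
  have ex := hs.2 x hx
  have ey := hs.2 y hy
  have ez := hs.2 _ hz
  have px := mul_le_mul_of_nonneg_left (le_of_le_of_eq (le_max_left _ _) ex.symm) ha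
  have py := mul_le_mul_of_nonneg_left (le_of_le_of_eq (le_max_left _ _) ey.symm) hb
  have ax := mul_le_mul_of_nonneg_left (le_of_le_of_eq (le_max_right _ _) ex.symm) ha
  have ay := mul_le_mul_of_nonneg_left (le_of_le_of_eq (le_max_right _ _) ey.symm) hb
  -- If the active action attains the maximum at the combined belief, affinity of the active value
  -- bounds `h` there by the combination of its values, contradicting the defect. So the passive
  -- action attains it, and the defect moves to the `T`-images.
  rcases max_choice (m + h (T p01 p11 (a * x + b * y))) ((a * x + b * y) +
    ((a * x + b * y) * h p11 + (1 - (a * x + b * y)) * h p01)) with hc | hc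
  · rw [hc] at ez
    refine ⟨ez, ?_⟩
    rw [T_combo hab] at ez
    obtain rfl : b = 1 - a := by linarith
    linarith
  · rw [hc] at ez
    obtain rfl : b = 1 - a := by linarith
    linarith

lemma IsAvgSolution.defect_iterate (hs : IsAvgSolution p01 p11 m g h)
    (h0 : p01 ∈ Icc (0 : ℝ) 1) (h1 : p11 ∈ Icc (0 : ℝ) 1)
    {x y a b : ℝ} (hx : x ∈ Icc (0 : ℝ) 1) (hy : y ∈ Icc (0 : ℝ) 1)
    (ha : 0 ≤ a) (hb : 0 ≤ b) (hab : a + b = 1)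
    (hE : 0 < h (a * x + b * y) - (a * h x + b * h y)) (n : ℕ) :
    h (a * x + b * y) - (a * h x + b * h y) ≤
      h (a * (T p01 p11)^[n] x + b * (T p01 p11)^[n] y)
        - (a * h ((T p01 p11)^[n] x) + b * h ((T p01 p11)^[n] y)) := by
  induction n with
  | zero => exact le_rfl
  | succ n ih =>
    simp only [Function.iterate_succ_apply']
    exact ih.trans (hs.convexity_defect (iterate_T_mem h0 h1 hx n) (iterate_T_mem h0 h1 hy n)
      ha hb hab (hE.trans_le ih)).2

lemma IsAvgSolution.convexOn (hs : IsAvgSolution p01 p11 m g h)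
    (h0 : p01 ∈ Icc (0 : ℝ) 1) (h1 : p11 ∈ Icc (0 : ℝ) 1) (h0' : 0 < p01) (h1' : p11 < 1)
    (hm : m < 1) : ConvexOn ℝ (Icc 0 1) h := by
  refine ⟨convex_Icc 0 1, fun x hx y hy a b ha hb hab => ?_⟩
  simp only [smul_eq_mul]
  by_contra! hlt
  have hE : 0 < h (a * x + b * y) - (a * h x + b * h y) := sub_pos.2 hlt
  by_cases hc : |p11 - p01| < 1
  -- Contracting case: the iterates of `x`, `y` and their combination all converge to `c`, so by
  -- continuity the defect along them tends to `0`, while it stays above its positive initial value.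
  · set c := p01 / (1 - (p11 - p01))
    have hcI : c ∈ Icc (0 : ℝ) 1 :=
      isClosed_Icc.mem_of_tendsto (tendsto_iterate_T hc x)
        (Eventually.of_forall (iterate_T_mem h0 h1 hx))
    have lim : ∀ u : ℕ → ℝ, (∀ n, u n ∈ Icc (0 : ℝ) 1) → Tendsto u atTop (𝓝 c) →
        Tendsto (fun n => h (u n)) atTop (𝓝 (h c)) := fun u hu hlim =>
      (hs.1 c hcI).tendsto.comp (tendsto_nhdsWithin_iff.2 ⟨hlim, Eventually.of_forall hu⟩)
    have hX := tendsto_iterate_T hc x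
    have hY := tendsto_iterate_T hc y
    have hcc : a * c + b * c = c := by rw [← add_mul, hab, one_mul]
    have hZ := (hX.const_mul a).add (hY.const_mul b)
    rw [hcc] at hZ
    have hdef := (lim _ (fun n => convex_Icc (0 : ℝ) 1 (iterate_T_mem h0 h1 hx n)
      (iterate_T_mem h0 h1 hy n) ha hb hab) hZ).sub
      (((lim _ (iterate_T_mem h0 h1 hx) hX).const_mul a).add
        ((lim _ (iterate_T_mem h0 h1 hy) hY).const_mul b))
    have := ge_of_tendsto' hdef (hs.defect_iterate h0 h1 hx hy ha hb hab hE)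
    rw [← add_mul, hab, one_mul, sub_self] at this
    exact absurd this hE.not_ge
  -- Since `0 < p01` and `p11 < 1`, the only other case is the deterministic flip `T ω = 1 - ω`,
  -- where iterates need not converge.
  · have hp : p01 = 1 ∧ p11 = 0 := by
      rcases le_abs'.1 (not_lt.1 hc) with h | h
      · constructor <;> linarith [h0.2, h1.1]
      · linarith
    obtain ⟨rfl, rfl⟩ := hp
    obtain ⟨e1, d1⟩ := hs.convexity_defect hx hy ha hb hab hE
    obtain ⟨e2, -⟩ := hs.convexity_defect (T_mem h0 h1 hx) (T_mem h0 h1 hy) ha hb hab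
      (hE.trans_le d1)
    -- The flip has period two, so resting at both points of the orbit gives `g = m`. But resting at
    -- belief `0` and acting at belief `1` gives `m + 1 ≤ 2 * g`, which contradicts `m < 1`.
    rw [← T_combo hab, show T 1 0 (T 1 0 (a * x + b * y)) = a * x + b * y by unfold T; ring] at e2
    have E0 := hs.2 0 (left_mem_Icc.2 zero_le_one)
    have E1 := hs.2 1 (right_mem_Icc.2 zero_le_one)
    have l0 := le_of_le_of_eq (le_max_left _ _) E0.symm
    have l1 := le_of_le_of_eq (le_max_right _ _) E1.symm
    simp only [T] at l0
    norm_num at l0 l1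
    linarith

lemma IsAvgSolution.concaveOn_advantage (hs : IsAvgSolution p01 p11 m g h)
    (h0 : p01 ∈ Icc (0 : ℝ) 1) (h1 : p11 ∈ Icc (0 : ℝ) 1) (h0' : 0 < p01) (h1' : p11 < 1)
    (hm : m < 1) : ConcaveOn ℝ (Icc 0 1) (advantage 1 p01 p11 m h) :=
  Whittle.concaveOn_advantage m zero_le_one h0 h1 (hs.convexOn h0 h1 h0' h1' hm)

lemma mem_avgPassiveSet_iff {ω : ℝ} : ω ∈ avgPassiveSet p01 p11 m ↔
    ω ∈ Icc (0 : ℝ) 1 ∧ ∃ (g : ℝ) (h : ℝ → ℝ), IsAvgSolution p01 p11 m g h ∧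
      advantage 1 p01 p11 m h ω ≤ 0 := by
  simp only [avgPassiveSet, mem_ofPred_eq, advantage, sub_nonpos, one_mul]

lemma avgPassiveSet_of_one_le (hm : 1 ≤ m) : avgPassiveSet p01 p11 m = Icc 0 1 := by
  refine Subset.antisymm (fun _ h => h.1) fun ω hω =>
    -- For `m ≥ 1` always resting earns `m` per slot, so gain `m` with zero relative value solves
    -- the optimality equation.
    ⟨hω, m, fun _ => 0, ⟨continuousOn_const, fun x hx => ?_⟩, ?_⟩
  · rw [max_eq_left (by linarith [hx.2])]
  · linarith [hω.2]

lemma isThresholdFamily_avgPassiveSet (h0 : p01 ∈ Icc (0 : ℝ) 1) (h1 : p11 ∈ Icc (0 : ℝ) 1)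
    (h0' : 0 < p01) (h1' : p11 < 1) : IsThresholdFamily (avgPassiveSet p01 p11) where
  eq_empty m hm := by
    refine eq_empty_of_forall_notMem fun ω hω => ?_
    obtain ⟨hI, g, h, hs, hle⟩ := mem_avgPassiveSet_iff.1 hω
    exact hle.not_gt (pos_of_concaveOn_advantage hm
      (hs.concaveOn_advantage h0 h1 h0' h1' (hm.trans one_pos)) hI)
  eq_Icc _ hm := avgPassiveSet_of_one_le hm
  lower m x hx y hy hyx := by
    rcases le_or_gt 1 m with hm | hm
    · rwa [avgPassiveSet_of_one_le hm]
    rcases hyx.eq_or_lt with rfl | hlt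
    · exact hx
    -- The solution that witnesses passivity of `x` also serves for `y`; uniqueness of solutions is
    -- not needed.
    obtain ⟨hI, g, h, hs, hle⟩ := mem_avgPassiveSet_iff.1 hx
    exact mem_avgPassiveSet_iff.2 ⟨hy, g, h, hs,
      (neg_of_concaveOn (hs.concaveOn_advantage h0 h1 h0' h1' hm)
        (by rw [advantage_one]; linarith) hy hI hlt hle).le⟩

end Average

/-! ### Queues sorted by belief -/

section Queue

variable {N K : ℕ} {p01 p11 : ℝ}

lemma belief_mem (h0 : p01 ∈ Icc (0 : ℝ) 1) (h1 : p11 ∈ Icc (0 : ℝ) 1) {Ω₁ : Fin N → ℝ}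
    (hΩ : ∀ i, Ω₁ i ∈ Icc (0 : ℝ) 1) (S : ℕ → Fin N → Bool) (U : ℕ → Finset (Fin N)) (t : ℕ)
    (i : Fin N) : belief p01 p11 Ω₁ S U t i ∈ Icc (0 : ℝ) 1 := by
  induction t with
  | zero => exact hΩ i
  | succ t ih =>
    simp only [belief]
    split_ifs
    · exact h1
    · exact h0
    · exact T_mem h0 h1 ih

lemma IsInitialQueue.nodup {Ω : Fin N → ℝ} {q : List (Fin N)} (hq : IsInitialQueue Ω q) :
    q.Nodup :=
  hq.1.nodup_iff.2 (List.nodup_finRange N)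

lemma IsInitialQueue.mem_drop_of_notMem_head {Ω : Fin N → ℝ} {q : List (Fin N)}
    (hq : IsInitialQueue Ω q) {i : Fin N} (hi : i ∉ head K q) : i ∈ q.drop K := by
  have : i ∈ q.take K ++ q.drop K := by
    rw [List.take_append_drop]; exact hq.1.mem_iff.2 (List.mem_finRange i)
  exact (List.mem_append.1 this).resolve_left fun h => hi (List.mem_toFinset.2 h)

lemma IsInitialQueue.notMem_head_of_mem_drop {Ω : Fin N → ℝ} {q : List (Fin N)}
    (hq : IsInitialQueue Ω q) {i : Fin N} (hi : i ∈ q.drop K) : i ∉ head K q := fun h => by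
  have hn := hq.nodup
  rw [← List.take_append_drop K q] at hn
  exact (List.disjoint_of_nodup_append hn) (List.mem_toFinset.1 h) hi

lemma IsInitialQueue.isIndexAction {Ω : Fin N → ℝ} {q : List (Fin N)} {W : ℝ → ℝ}
    (hq : IsInitialQueue Ω q) (hKN : K ≤ N) (hΩ : ∀ i, Ω i ∈ Icc (0 : ℝ) 1)
    (hW : MonotoneOn W (Icc 0 1)) : IsIndexAction W K Ω (head K q) := by
  refine ⟨?_, fun i hi j hj => hW (hΩ j) (hΩ i) ?_⟩
  · rw [head, List.toFinset_card_of_nodup (hq.nodup.sublist (List.take_sublist K q)),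
      List.length_take, hq.1.length_eq, List.length_finRange, min_eq_left hKN]
  · have hp := hq.2
    rw [← List.take_append_drop K q] at hp
    exact (List.pairwise_append.1 hp).2.2 i (List.mem_toFinset.1 hi) j
      (hq.mem_drop_of_notMem_head hj)

lemma QueueStep.perm {positive : Prop} {s : Fin N → Bool} {q q' : List (Fin N)}
    (h : QueueStep positive K s q q') : q'.Perm q := by
  obtain ⟨ones, zeros, ho, hz, hpos, hneg⟩ := h
  have hf : (ones ++ zeros).Perm (q.take K) :=
    (ho.append hz).trans (List.filter_append_perm _ _)
  have hq : (ones ++ zeros ++ q.drop K).Perm q := by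
    simpa using hf.append_right (q.drop K)
  by_cases hp : positive
  · rw [hpos hp]
    refine List.Perm.trans ?_ hq
    rw [List.append_assoc, List.append_assoc]
    exact List.perm_append_comm.append_left ones
  · rw [hneg hp]
    refine List.Perm.trans ?_ hq
    refine List.Perm.trans ?_ (List.perm_append_comm.append_right _ : (zeros ++ ones ++ _).Perm _)
    rw [List.append_assoc, List.append_assoc]
    exact (List.perm_append_comm.trans
      ((List.reverse_perm _).append_left ones)).append_left zeros

/-- The reordering rule turns a queue sorted by belief into a queue sorted by the next beliefs. -/
lemma IsInitialQueue.step (h0 : p01 ∈ Icc (0 : ℝ) 1) (h1 : p11 ∈ Icc (0 : ℝ) 1) {Ω₁ : Fin N → ℝ}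
    (hΩ : ∀ i, Ω₁ i ∈ Icc (0 : ℝ) 1) (S : ℕ → Fin N → Bool) (U : ℕ → Finset (Fin N)) (t : ℕ)
    {q q' : List (Fin N)} (hq : IsInitialQueue (belief p01 p11 Ω₁ S U t) q)
    (hU : U t = head K q) (h : QueueStep (p01 ≤ p11) K (S t) q q') :
    IsInitialQueue (belief p01 p11 Ω₁ S U (t + 1)) q' := by
  refine ⟨h.perm.trans hq.1, ?_⟩
  obtain ⟨ones, zeros, ho, hz, hpos, hneg⟩ := h
  set ω := belief p01 p11 Ω₁ S U t with hω
  set ω' := belief p01 p11 Ω₁ S U (t + 1) with hω'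
  have hωI : ∀ i, ω i ∈ Icc (0 : ℝ) 1 := belief_mem h0 h1 hΩ S U t
  have hones : ∀ i ∈ ones, ω' i = p11 := fun i hi => by
    have := List.mem_filter.1 (ho.mem_iff.1 hi)
    have hm : i ∈ U t := by rw [hU]; exact List.mem_toFinset.2 this.1
    simp [hω', belief, hm, this.2]
  have hzeros : ∀ i ∈ zeros, ω' i = p01 := fun i hi => by
    have := List.mem_filter.1 (hz.mem_iff.1 hi)
    have hm : i ∈ U t := by rw [hU]; exact List.mem_toFinset.2 this.1
    have hS : S t i = false := by simpa using this.2
    simp [hω', belief, hm, hS]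
  -- In this form the new belief of an unobserved channel visibly lies between `p01` and `p11`, and
  -- depends on the old one with slope `p11 - p01`: the sign of the slope decides whether the order
  -- is kept or reversed.
  have hrest : ∀ i ∈ q.drop K, ω' i = p01 + ω i * (p11 - p01) := fun i hi => by
    have hm : i ∉ U t := by rw [hU]; exact hq.notMem_head_of_mem_drop hi
    simp only [hω', belief, hm, if_false, T]
    ring
  have hsorted : (q.drop K).Pairwise fun i j => ω j ≤ ω i := hq.2.sublist (List.drop_sublist K q)
  have hconst : ∀ (l : List (Fin N)) (c : ℝ), (∀ i ∈ l, ω' i = c) →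
      l.Pairwise fun i j => ω' j ≤ ω' i := fun l c hl =>
    List.pairwise_of_forall_mem_list fun i hi j hj => (by rw [hl i hi, hl j hj])
  by_cases hp : p01 ≤ p11
  · have hd : 0 ≤ p11 - p01 := sub_nonneg.2 hp
    rw [hpos hp, List.append_assoc, List.pairwise_append, List.pairwise_append]
    refine ⟨hconst _ _ hones, ⟨?_, hconst _ _ hzeros, ?_⟩, ?_⟩
    · refine hsorted.imp_of_mem fun hi hj hij => ?_
      rw [hrest _ hi, hrest _ hj]
      linarith [mul_le_mul_of_nonneg_right hij hd]
    · intro i hi j hj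
      rw [hrest i hi, hzeros j hj]
      linarith [mul_nonneg (hωI i).1 hd]
    · intro i hi j hj
      rw [hones i hi]
      rcases List.mem_append.1 hj with hj | hj
      · rw [hrest j hj]
        linarith [mul_le_mul_of_nonneg_right (hωI j).2 hd]
      · rwa [hzeros j hj]
  · have hd : 0 ≤ p01 - p11 := by linarith
    rw [hneg hp, List.append_assoc, List.pairwise_append, List.pairwise_append]
    refine ⟨hconst _ _ hzeros, ⟨?_, hconst _ _ hones, ?_⟩, ?_⟩
    · rw [List.pairwise_reverse]
      refine hsorted.imp_of_mem fun hi hj hij => ?_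
      rw [hrest _ hi, hrest _ hj]
      linarith [mul_le_mul_of_nonneg_right hij hd]
    · intro i hi j hj
      rw [hrest i (List.mem_reverse.1 hi), hones j hj]
      linarith [mul_le_mul_of_nonneg_right (hωI i).2 hd]
    · intro i hi j hj
      rw [hzeros i hi]
      rcases List.mem_append.1 hj with hj | hj
      · rw [hrest j (List.mem_reverse.1 hj)]
        linarith [mul_nonneg (hωI j).1 hd]
      · rw [hones j hj]; linarith

/-- Sortedness by the current beliefs is the invariant of the queue rule; `IsInitialQueue` is used
here with the belief vector of slot `t` in place of the initial one. -/
lemma IsQueueRun.isInitialQueue (h0 : p01 ∈ Icc (0 : ℝ) 1) (h1 : p11 ∈ Icc (0 : ℝ) 1)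
    {Ω₁ : Fin N → ℝ} (hΩ : ∀ i, Ω₁ i ∈ Icc (0 : ℝ) 1) {S : ℕ → Fin N → Bool}
    {Q : ℕ → List (Fin N)} (hQ : IsQueueRun (p01 ≤ p11) K Ω₁ S Q) (t : ℕ) :
    IsInitialQueue (belief p01 p11 Ω₁ S (fun s => head K (Q s)) t) (Q t) := by
  induction t with
  | zero => exact hQ.1
  | succ t ih => exact ih.step h0 h1 hΩ S _ t rfl (hQ.2 t)

lemma IsQueueRun.isIndexAction (hKN : K ≤ N) (h0 : p01 ∈ Icc (0 : ℝ) 1)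
    (h1 : p11 ∈ Icc (0 : ℝ) 1) {Ω₁ : Fin N → ℝ} (hΩ : ∀ i, Ω₁ i ∈ Icc (0 : ℝ) 1)
    {S : ℕ → Fin N → Bool} {Q : ℕ → List (Fin N)} (hQ : IsQueueRun (p01 ≤ p11) K Ω₁ S Q)
    {W : ℝ → ℝ} (hW : MonotoneOn W (Icc 0 1)) (t : ℕ) :
    IsIndexAction W K (belief p01 p11 Ω₁ S (fun s => head K (Q s)) t) (head K (Q t)) :=
  (hQ.isInitialQueue h0 h1 hΩ t).isIndexAction hKN (belief_mem h0 h1 hΩ S _ t) hW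

/-! ### From index actions back to queues -/

lemma exists_sorted_toList (Ω : Fin N → ℝ) (U : Finset (Fin N)) :
    ∃ l : List (Fin N), l.Perm U.toList ∧ l.Pairwise fun i j => Ω j ≤ Ω i := by
  classical
  refine ⟨U.toList.insertionSort (fun i j => Ω j ≤ Ω i), List.perm_insertionSort _ _, ?_⟩
  have : Std.Total fun i j : Fin N => Ω j ≤ Ω i := ⟨fun i j => le_total _ _⟩
  have : IsTrans (Fin N) fun i j => Ω j ≤ Ω i := ⟨fun i j k hij hjk => hjk.trans hij⟩
  exact List.pairwise_insertionSort _ _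

/-- If `U` collects `K` largest beliefs, some sorted queue has `U` at its head. -/
lemma exists_isInitialQueue_head {Ω : Fin N → ℝ} {U : Finset (Fin N)} (hU : U.card = K)
    (hle : ∀ i ∈ U, ∀ j ∉ U, Ω j ≤ Ω i) :
    ∃ q : List (Fin N), IsInitialQueue Ω q ∧ U = head K q := by
  classical
  obtain ⟨l, hl, hls⟩ := exists_sorted_toList Ω U
  obtain ⟨r, hr, hrs⟩ := exists_sorted_toList Ω Uᶜ
  have hlm : ∀ i, i ∈ l ↔ i ∈ U := fun i => by rw [hl.mem_iff, Finset.mem_toList]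
  have hrm : ∀ i, i ∈ r ↔ i ∉ U := fun i => by
    rw [hr.mem_iff, Finset.mem_toList, Finset.mem_compl]
  refine ⟨l ++ r, ⟨?_, ?_⟩, ?_⟩
  · rw [List.perm_ext_iff_of_nodup _ (List.nodup_finRange N)]
    · intro i
      simp [hlm, hrm, em]
    · rw [List.nodup_append']
      exact ⟨hl.nodup_iff.2 U.nodup_toList, hr.nodup_iff.2 (Finset.nodup_toList _),
        fun i hi hi' => (hrm i).1 hi' ((hlm i).1 hi)⟩
  · exact List.pairwise_append.2 ⟨hls, hrs, fun i hi j hj =>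
      hle i ((hlm i).1 hi) j ((hrm j).1 hj)⟩
  · have hlen : l.length = K := by rw [hl.length_eq, Finset.length_toList, hU]
    rw [head, ← hlen, List.take_left]
    ext i
    rw [List.mem_toFinset, hlm]

lemma exists_queueStep (positive : Prop) (K : ℕ) (s : Fin N → Bool) (q : List (Fin N)) :
    ∃ q', QueueStep positive K s q q' := by
  by_cases hp : positive
  · exact ⟨_, _, _, .refl _, .refl _, fun _ => rfl, fun h => absurd hp h⟩
  · exact ⟨_, _, _, .refl _, .refl _, fun h => absurd h hp, fun _ => rfl⟩

/-- Two queues sorted by the same beliefs differ by exchanging channels of equal belief. -/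
lemma IsInitialQueue.map_eq {Ω : Fin N → ℝ} {q q' : List (Fin N)} (hq : IsInitialQueue Ω q)
    (hq' : IsInitialQueue Ω q') : q.map Ω = q'.map Ω :=
  ((hq.1.trans hq'.1.symm).map Ω).eq_of_pairwise (le := fun a b => b ≤ a)
    (fun _ _ _ _ h h' => le_antisymm h' h)
    (List.pairwise_map.2 hq.2) (List.pairwise_map.2 hq'.2)

lemma exists_queues_of_isIndexAction (h0 : p01 ∈ Icc (0 : ℝ) 1) (h1 : p11 ∈ Icc (0 : ℝ) 1)
    {Ω₁ : Fin N → ℝ} (hΩ : ∀ i, Ω₁ i ∈ Icc (0 : ℝ) 1) (S : ℕ → Fin N → Bool)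
    {W : ℝ → ℝ} (hW : StrictMonoOn W (Icc 0 1)) (U : ℕ → Finset (Fin N))
    (hU : ∀ t, IsIndexAction W K (belief p01 p11 Ω₁ S U t) (U t)) :
    ∃ Q : ℕ → List (Fin N), IsInitialQueue Ω₁ (Q 0) ∧ (∀ t, (Q t).Perm (List.finRange N)) ∧
      (∀ t, U t = head K (Q t)) ∧
      ∀ t, ∃ q' : List (Fin N), QueueStep (p01 ≤ p11) K (S t) (Q t) q' ∧
        q'.map (belief p01 p11 Ω₁ S U (t + 1)) =
          (Q (t + 1)).map (belief p01 p11 Ω₁ S U (t + 1)) := by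
  have hmem := belief_mem h0 h1 hΩ S U
  -- Strict monotonicity turns largest indices into largest beliefs. The queues are chosen slot by
  -- slot, independently of each other; they are linked afterwards because the updated queue and the
  -- next chosen one are sorted by the same beliefs.
  choose Q hQ hQU using fun t => exists_isInitialQueue_head (hU t).1 fun i hi j hj =>
    (hW.le_iff_le (hmem t j) (hmem t i)).1 ((hU t).2 i hi j hj)
  refine ⟨Q, hQ 0, fun t => (hQ t).1, hQU, fun t => ?_⟩
  obtain ⟨q', hq'⟩ := exists_queueStep (p01 ≤ p11) K (S t) (Q t)
  exact ⟨q', hq', ((hQ t).step h0 h1 hΩ S U t (hQU t) hq').map_eq (hQ (t + 1))⟩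

end Queue

end Whittle

theorem mainTheorem7 {N K : ℕ} (hK : 1 ≤ K) (hKN : K < N)
    (p01 p11 : ℝ) (hp01 : p01 ∈ Set.Icc (0 : ℝ) 1) (hp11 : p11 ∈ Set.Icc (0 : ℝ) 1)
    (Ω₁ : Fin N → ℝ) (hΩ₁ : ∀ i, Ω₁ i ∈ Set.Icc (0 : ℝ) 1)
    (S : ℕ → Fin N → Bool) :
    -- discounted reward criterion
    (∀ β ∈ Set.Ico (0 : ℝ) 1,
      -- the index is a genuine infimum
      (∀ ω ∈ Set.Icc (0 : ℝ) 1,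
        IsGLB {m : ℝ | ω ∈ Whittle.passiveSet β p01 p11 m}
          (Whittle.index (Whittle.passiveSet β p01 p11) ω)) ∧
      -- the queue rule is a Whittle index policy
      (∀ Q : ℕ → List (Fin N), Whittle.IsQueueRun (p01 ≤ p11) K Ω₁ S Q →
        ∀ t, Whittle.IsIndexAction (Whittle.index (Whittle.passiveSet β p01 p11)) K
          (Whittle.belief p01 p11 Ω₁ S (fun s => Whittle.head K (Q s)) t)
          (Whittle.head K (Q t))) ∧
      -- every Whittle index policy is the queue rule, up to exchanging channels of equal belief
      (∀ U : ℕ → Finset (Fin N),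
        (∀ t, Whittle.IsIndexAction (Whittle.index (Whittle.passiveSet β p01 p11)) K
          (Whittle.belief p01 p11 Ω₁ S U t) (U t)) →
        ∃ Q : ℕ → List (Fin N),
          Whittle.IsInitialQueue Ω₁ (Q 0) ∧
          (∀ t, (Q t).Perm (List.finRange N)) ∧
          (∀ t, U t = Whittle.head K (Q t)) ∧
          ∀ t, ∃ q' : List (Fin N), Whittle.QueueStep (p01 ≤ p11) K (S t) (Q t) q' ∧
            q'.map (Whittle.belief p01 p11 Ω₁ S U (t + 1)) =
              (Q (t + 1)).map (Whittle.belief p01 p11 Ω₁ S U (t + 1)))) ∧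
    -- average reward criterion, no absorbing state
    (0 < p01 → p11 < 1 →
      (∀ ω ∈ Set.Icc (0 : ℝ) 1,
        IsGLB {m : ℝ | ω ∈ Whittle.avgPassiveSet p01 p11 m}
          (Whittle.index (Whittle.avgPassiveSet p01 p11) ω)) ∧
      (∀ Q : ℕ → List (Fin N), Whittle.IsQueueRun (p01 ≤ p11) K Ω₁ S Q →
        ∀ t, Whittle.IsIndexAction (Whittle.index (Whittle.avgPassiveSet p01 p11)) K
          (Whittle.belief p01 p11 Ω₁ S (fun s => Whittle.head K (Q s)) t)
          (Whittle.head K (Q t)))) := by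
  have fwd := fun {W : ℝ → ℝ} (hW : MonotoneOn W (Set.Icc 0 1)) Q
      (hQ : Whittle.IsQueueRun (p01 ≤ p11) K Ω₁ S Q) =>
    hQ.isIndexAction hKN.le hp01 hp11 hΩ₁ hW
  refine ⟨fun β hβ => ?_, fun h0 h1 => ?_⟩
  · have hP := Whittle.isThresholdFamily_passiveSet hβ hp01 hp11
    exact ⟨fun _ => hP.isGLB, fwd hP.monotoneOn,
      Whittle.exists_queues_of_isIndexAction hp01 hp11 hΩ₁ S
        (Whittle.strictMonoOn_index_passiveSet hβ hp01 hp11)⟩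
  · have hP := Whittle.isThresholdFamily_avgPassiveSet hp01 hp11 h0 h1
    exact ⟨fun _ => hP.isGLB, fwd hP.monotoneOn⟩
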